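/- Let $k$ be an algebraically closed field and $G$ a linear algebraic group over $k$. A $G$-module is a finite-dimensional rational representation $V$ of $G$. Write $k[V]$ for the ring of polynomial functions on $V$, with $G$ acting by $(g\cdot f)(v)=f(g^{-1}v)$, write $k[V]^G_{\le d}$ for the set of invariants of degree at most $d$, and let the nullcone $\mathcal N_{G,V}\subseteq V$ be the common zero set of all invariants in $k[V]^G$ with zero constant term. Let $\delta(G,V)$ be the least $d\ge 0$ such that for every $v\in V^G\setminus\mathcal N_{G,V}$ there is an $f\in k[V]^G_{\le d}$ with zero constant term and $f(v)\neq 0$, and let $\delta(G)\in\mathbb N\cup\{\infty\}$ be the supremum of $\delta(G,V)$ over all $G$-modules $V$. Call $G$ reductive (that is, geometrically reductive) if $V^G\cap\mathcal N_{G,V}=\{0\}$ for every $G$-module $V$. Let $N$ be a closed normal subgroup of $G$ such that $G/N$ is reductive. Then for every $G$-module $V$ (regarded also as an $N$-module) \[\delta(G,V)\;\le\;\delta(N,V)\,\delta(G/N)\;\le\;\delta(N)\,\delta(G/N),\] and hence $\delta(G)\le\delta(N)\,\delta(G/N)$. In particular, if $G^0$ denotes the connected component of the identity of $G$, then \[\delta(G)\;\le\;\delta(G/G^0)\,\delta(G^0).\]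 -/

import Mathlib

universe u v w

noncomputable section

namespace LinAlgGroup

/-! ### Linear algebraic groups

A linear algebraic group over an algebraically closed field `k` is a group `G` together with its
algebra `A = k[G]` of regular functions, realised as an algebra of functions `G → k`. -/

section Groups

set_option linter.unusedSectionVars false

variable {k : Type u} [Field k] {G : Type w} [Group G]

/-- `A` is the coordinate ring of a structure of affine algebraic group on `G`: it is finitely
generated, evaluation identifies `G` with the set of `k`-algebra maps `A → k` (so `G` is an affine
variety with coordinate ring `A`), and multiplication `G × G → G` and inversion `G → G` are
morphisms of varieties (`k[G × G] = k[G] ⊗ k[G]` is the span of the functions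
`(x, y) ↦ a x * b y`). -/
structure IsLinearAlgebraicGroup (A : Subalgebra k (G → k)) : Prop where
  fg : A.FG
  points : ∀ φ : A →ₐ[k] k, ∃! g : G, ∀ f : A, φ f = (f : G → k) g
  mul : ∀ f ∈ A, (fun p : G × G => f (p.1 * p.2)) ∈
    Submodule.span k {F : G × G → k | ∃ a ∈ A, ∃ b ∈ A, F = fun p => a p.1 * b p.2}
  inv : ∀ f ∈ A, (fun g => f g⁻¹) ∈ A

/-- The Zariski topology on `G`: the sets `{g | f g ≠ 0}`, for `f` regular, form a basis. -/
abbrev zariskiTopology (A : Subalgebra k (G → k)) : TopologicalSpace G :=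
  TopologicalSpace.generateFrom {U | ∃ f ∈ A, U = {g | f g ≠ 0}}

/-- Pulling functions back along a map, as an algebra homomorphism. -/
def pullback (k : Type u) [Field k] {X Y : Type w} (π : X → Y) : (Y → k) →ₐ[k] (X → k) where
  toFun f := f ∘ π
  map_one' := rfl
  map_mul' _ _ := rfl
  map_zero' := rfl
  map_add' _ _ := rfl
  commutes' _ := rfl

/-- The regular functions on a closed subgroup `N` of `G`: the restrictions to `N` of the regular
functions on `G`. -/
def restrictRegular (A : Subalgebra k (G → k)) (N : Subgroup G) : Subalgebra k (N → k) :=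
  A.map (pullback k (Subtype.val : N → G))

/-- The regular functions on the quotient `G ⧸ N` by a closed normal subgroup: the functions whose
pullback to `G` is regular, so that `k[G ⧸ N] = k[G]^N`. -/
def quotientRegular (A : Subalgebra k (G → k)) (N : Subgroup G) : Subalgebra k (G ⧸ N → k) :=
  A.comap (pullback k (QuotientGroup.mk : G → G ⧸ N))

namespace IsLinearAlgebraicGroup

variable {A : Subalgebra k (G → k)}

theorem mul_left (hA : IsLinearAlgebraicGroup A) (x : G) {f : G → k} (hf : f ∈ A) :
    (fun g => f (x * g)) ∈ A := by
  have key : ∀ F ∈ Submodule.span k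
      {F : G × G → k | ∃ a ∈ A, ∃ b ∈ A, F = fun p => a p.1 * b p.2},
      (fun g => F (x, g)) ∈ A := by
    intro F hF
    induction hF using Submodule.span_induction with
    | mem F h =>
      obtain ⟨a, _, b, hb, rfl⟩ := h
      exact A.smul_mem hb (a x)
    | zero => exact A.zero_mem
    | add F₁ F₂ _ _ h₁ h₂ => exact A.add_mem h₁ h₂
    | smul c F _ h => exact A.smul_mem h c
  exact key _ (hA.mul f hf)

theorem mul_right (hA : IsLinearAlgebraicGroup A) (x : G) {f : G → k} (hf : f ∈ A) :
    (fun g => f (g * x)) ∈ A := by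
  have h := hA.inv _ (hA.mul_left x⁻¹ (hA.inv f hf))
  simpa using h

theorem continuous_of_pullback {φ : G → G} (hφ : ∀ f ∈ A, (fun g => f (φ g)) ∈ A) :
    @Continuous G G (zariskiTopology A) (zariskiTopology A) φ := by
  let _ := zariskiTopology A
  refine continuous_generateFrom_iff.2 ?_
  rintro U ⟨f, hf, rfl⟩
  exact TopologicalSpace.isOpen_generateFrom_of_mem ⟨_, hφ f hf, rfl⟩

/-- The identity component `G⁰`: the connected component of `1` in the Zariski topology. -/
def identityComponent (hA : IsLinearAlgebraicGroup A) : Subgroup G where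
  carrier := @connectedComponent G (zariskiTopology A) 1
  one_mem' := @mem_connectedComponent G (zariskiTopology A) 1
  mul_mem' {a b} ha hb := by
    let _ := zariskiTopology A
    have h := (continuous_of_pullback (fun f hf => hA.mul_left a hf)).image_connectedComponent_subset
      1 (Set.mem_image_of_mem _ hb)
    rw [mul_one, ← connectedComponent_eq ha] at h
    exact h
  inv_mem' {a} ha := by
    let _ := zariskiTopology A
    have h := (continuous_of_pullback (fun f hf => hA.inv f hf)).image_connectedComponent_subset
      1 (Set.mem_image_of_mem _ ha)
    rwa [inv_one] at h

instance identityComponent_normal (hA : IsLinearAlgebraicGroup A) :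
    hA.identityComponent.Normal where
  conj_mem n hn g := by
    let _ := zariskiTopology A
    have h := (continuous_of_pullback (A := A) (φ := fun x => g * x * g⁻¹) (fun f hf =>
      hA.mul_left g (hA.mul_right g⁻¹ hf))).image_connectedComponent_subset
      1 (Set.mem_image_of_mem _ hn)
    simp only [mul_one, mul_inv_cancel] at h
    exact h

end IsLinearAlgebraicGroup

end Groups

/-! ### Polynomial functions on a vector space -/

section Polynomials

variable (k : Type u) [Field k] (V : Type v) [AddCommGroup V] [Module k V]

/-- The linear forms on `V`, as a space of functions `V → k`. -/
def linearForms : Submodule k (V → k) :=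
  LinearMap.range (LinearMap.ltoFun k V k k)

/-- `k[V]_{≤ d}`: the polynomial functions of degree at most `d`, that is, the linear combinations
of products of at most `d` linear forms. -/
def polyFunLE (d : ℕ) : Submodule k (V → k) :=
  ⨆ i ∈ Finset.range (d + 1), linearForms k V ^ i

/-- `k[V]`: the ring of all polynomial functions on `V`, generated by the linear forms. -/
def polyFun : Subalgebra k (V → k) :=
  Algebra.adjoin k (linearForms k V : Set (V → k))

end Polynomials

/-! ### Representations, nullcone and the number `δ` -/

section Delta

variable {k : Type u} [Field k] {G : Type w} [Group G]

/-- A representation is rational if all its matrix coefficients are regular functions on `G`.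
A `G`-module is a finite-dimensional rational representation. -/
def IsRational (A : Subalgebra k (G → k)) {V : Type v} [AddCommGroup V] [Module k V]
    (ρ : Representation k G V) : Prop :=
  ∀ (φ : Module.Dual k V) (x : V), (fun g => φ (ρ g x)) ∈ A

variable {V : Type v} [AddCommGroup V] [Module k V]

/-- A function on `V` is invariant if `g • f = f` for all `g`, where `(g • f) x = f (g⁻¹ x)`. -/
def IsInvariant (ρ : Representation k G V) (f : V → k) : Prop :=
  ∀ g : G, (fun x => f (ρ g⁻¹ x)) = f

/-- `k[V]^G`. -/
def polyInvariants (ρ : Representation k G V) : Set (V → k) :=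
  {f | f ∈ polyFun k V ∧ IsInvariant ρ f}

/-- `k[V]^G_{≤ d}`. -/
def polyInvariantsLE (ρ : Representation k G V) (d : ℕ) : Set (V → k) :=
  {f | f ∈ polyFunLE k V d ∧ IsInvariant ρ f}

/-- `S₊`: the elements of `S` with constant term zero. -/
def plusPart (S : Set (V → k)) : Set (V → k) :=
  {f | f ∈ S ∧ f 0 = 0}

/-- The nullcone: the common zero set of `k[V]^G₊`. -/
def nullcone (ρ : Representation k G V) : Set V :=
  {x | ∀ f ∈ plusPart (polyInvariants ρ), f x = 0}

/-- `S` is a `δ`-set: every fixed point outside the nullcone is separated from `0` by `S₊`. -/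
def IsDeltaSet (ρ : Representation k G V) (S : Set (V → k)) : Prop :=
  ∀ x : V, x ∈ ρ.invariants → x ∉ nullcone ρ → ∃ f ∈ plusPart S, f x ≠ 0

/-- `δ(G, V)`: the least `d` for which `k[V]^G_{≤ d}` is a `δ`-set. -/
def delta (ρ : Representation k G V) : ℕ∞ :=
  ⨅ (d : ℕ) (_ : IsDeltaSet ρ (polyInvariantsLE ρ d)), (d : ℕ∞)

/-- `δ(G)`: the supremum of `δ(G, V)` over all `G`-modules `V`. Every `G`-module is isomorphic
to one in the universe of `k`. -/
def deltaGroup (A : Subalgebra k (G → k)) : ℕ∞ :=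
  ⨆ (V : Type u) (_ : AddCommGroup V) (_ : Module k V) (_ : FiniteDimensional k V)
    (ρ : Representation k G V) (_ : IsRational A ρ), delta ρ

/-- (Geometric) reductivity: `V^G` meets the nullcone only in `0`, for every `G`-module `V`. -/
def IsReductive (A : Subalgebra k (G → k)) : Prop :=
  ∀ (V : Type u) [AddCommGroup V] [Module k V] [FiniteDimensional k V] (ρ : Representation k G V),
    IsRational A ρ → (ρ.invariants : Set V) ∩ nullcone ρ = {0}

end Delta

end LinAlgGroup

end

open LinAlgGroup
open scoped Topology

/-!
# The number `δ` of a group and of a normal subgroup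

Let `x` be a `G`-fixed point of `V` outside the nullcone and let `d = δ(N, V)`. Since `k[V]^G` is
contained in `k[V]^N`, the point `x` lies outside the nullcone of `N` as well, so some element of
`W = (k[V]^N_{≤ d})₊` does not vanish at `x`. The group `G ⧸ N` acts on `W` and on its dual, and
`y ↦ ev_y` is an equivariant polynomial map `V → W*` of degree at most `d` sending `0` to `0`
(`evalInvariantsPlus_map`, `comp_evalInvariantsPlus_mem`). The dual is rational because it is
spanned by evaluations (`isRational_dualInvariantsPlus`). Now `ev_x` is a nonzero fixed point of
`W*`, so, `G ⧸ N` being reductive, it lies outside the nullcone, and there is an invariant of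
degree at most `δ(G ⧸ N)` without constant term which does not vanish at `ev_x`. Its pullback to
`V` is a `G`-invariant of degree at most `d * δ(G ⧸ N)` which does not vanish at `x`
(`isDeltaSet_mul`).

For the identity component, the quotient is finite because the Zariski topology is Noetherian
(`IsLinearAlgebraicGroup.finite_quotient_identityComponent`), and finite groups are reductive: a
fixed point is separated from `0` by the product of the translates of a linear form
(`isReductive_of_finite`).
-/

namespace LinAlgGroup

/-! ### Polynomial functions of bounded degree -/

section PolynomialFunctions

variable {k : Type u} [Field k] {V : Type*} [AddCommGroup V] [Module k V]

theorem dual_mem_linearForms (φ : Module.Dual k V) : (φ : V → k) ∈ linearForms k V :=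
  ⟨φ, rfl⟩

/-- This turns statements about degrees into statements about powers of one subspace. -/
theorem polyFunLE_eq_pow (d : ℕ) : polyFunLE k V d = (1 ⊔ linearForms k V) ^ d := by
  refine le_antisymm (iSup₂_le fun i hi => ?_) ?_
  · exact (pow_le_pow_left' le_sup_right i).trans
      (pow_le_pow_right' le_sup_left (Finset.mem_range_succ_iff.1 hi))
  · induction d with
    | zero => simp [polyFunLE]
    | succ d ih =>
      rw [pow_succ]
      refine (mul_le_mul_left ih _).trans ?_
      rw [Submodule.mul_sup, mul_one]
      refine sup_le ?_ ?_
      · exact biSup_mono fun i hi => by simp at hi ⊢; omega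
      · simp only [polyFunLE, Submodule.iSup_mul, ← pow_succ]
        refine iSup₂_le fun i hi => ?_
        exact le_iSup₂_of_le (i + 1) (by simp at hi ⊢; omega) le_rfl

theorem polyFunLE_le_polyFun (d : ℕ) :
    polyFunLE k V d ≤ Subalgebra.toSubmodule (polyFun k V) := by
  have hL : 1 ⊔ linearForms k V ≤ Subalgebra.toSubmodule (polyFun k V) :=
    sup_le (Submodule.one_le.2 (polyFun k V).one_mem) Algebra.subset_adjoin
  rw [polyFunLE_eq_pow]
  induction d with
  | zero => exact le_sup_left.trans hL
  | succ d ih =>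
    rw [pow_succ]
    exact Submodule.mul_le.2 fun f hf g hg => (polyFun k V).mul_mem (ih hf) (hL hg)

theorem linearForms_le_polyFunLE_one : linearForms k V ≤ polyFunLE k V 1 := by
  rw [polyFunLE_eq_pow, pow_one]
  exact le_sup_right

theorem polyFunLE_mono {d e : ℕ} (h : d ≤ e) : polyFunLE k V d ≤ polyFunLE k V e :=
  biSup_mono fun i hi => by simp at hi ⊢; omega

theorem eq_zero_of_mem_polyFunLE_zero {f : V → k} (hf : f ∈ polyFunLE k V 0) (hf0 : f 0 = 0) :
    f = 0 := by
  rw [polyFunLE_eq_pow, pow_zero] at hf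
  obtain ⟨c, rfl⟩ := Submodule.mem_one.1 hf
  exact funext fun _ => hf0

instance finite_polyFunLE [FiniteDimensional k V] (d : ℕ) : Module.Finite k (polyFunLE k V d) := by
  rw [polyFunLE_eq_pow, Module.Finite.iff_fg]
  refine Submodule.FG.pow (Submodule.FG.sup ?_ ?_) d
  · rw [Submodule.one_eq_span]
    exact Submodule.fg_span_singleton _
  · exact Module.Finite.iff_fg.1 (Module.Finite.range _)

variable {V' : Type*} [AddCommGroup V'] [Module k V']

theorem comp_mem_polyFun (T : V →ₗ[k] V') {f : V' → k} (hf : f ∈ polyFun k V') :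
    f ∘ T ∈ polyFun k V := by
  induction hf using Algebra.adjoin_induction with
  | mem f h =>
    obtain ⟨φ, rfl⟩ := h
    exact Algebra.subset_adjoin (dual_mem_linearForms (φ ∘ₗ T))
  | algebraMap c => exact (polyFun k V).algebraMap_mem c
  | add f g _ _ hf hg => exact (polyFun k V).add_mem hf hg
  | mul f g _ _ hf hg => exact (polyFun k V).mul_mem hf hg

/-- Degrees multiply under composition with a polynomial map, here a map all of whose coordinate
functions have degree at most `d`. -/
theorem comp_mem_polyFunLE {Φ : V → V'} {d e : ℕ}
    (hΦ : ∀ φ : Module.Dual k V', φ ∘ Φ ∈ polyFunLE k V d) {f : V' → k}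
    (hf : f ∈ polyFunLE k V' e) : f ∘ Φ ∈ polyFunLE k V (d * e) := by
  have key : ∀ f ∈ (1 ⊔ linearForms k V' : Submodule k (V' → k)),
      f ∘ Φ ∈ polyFunLE k V d := by
    intro f hf
    obtain ⟨g, hg, h, ⟨φ, rfl⟩, rfl⟩ := Submodule.mem_sup.1 hf
    obtain ⟨c, rfl⟩ := Submodule.mem_one.1 hg
    refine (polyFunLE k V d).add_mem ?_ (hΦ φ)
    rw [polyFunLE_eq_pow]
    exact one_le_pow₀ (M₀ := Submodule k (V → k)) le_sup_left (Submodule.mem_one.2 ⟨c, rfl⟩)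
  rw [polyFunLE_eq_pow] at hf
  rw [polyFunLE_eq_pow, pow_mul, ← polyFunLE_eq_pow]
  induction e generalizing f with
  | zero =>
    obtain ⟨c, rfl⟩ := Submodule.mem_one.1 (by simpa using hf)
    exact Submodule.mem_one.2 ⟨c, rfl⟩
  | succ e ih =>
    rw [pow_succ] at hf
    induction hf using Submodule.mul_induction_on' with
    | mem_mul_mem f hf g hg =>
      rw [pow_succ]
      exact Submodule.mul_mem_mul (ih hf) (key g hg)
    | add f _ g _ hf hg => exact Submodule.add_mem _ hf hg

theorem comp_linear_mem_polyFunLE (T : V →ₗ[k] V') {d : ℕ} {f : V' → k}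
    (hf : f ∈ polyFunLE k V' d) : f ∘ T ∈ polyFunLE k V d := by
  have h := comp_mem_polyFunLE (Φ := T)
    (fun φ => linearForms_le_polyFunLE_one (dual_mem_linearForms (φ ∘ₗ T))) hf
  rwa [one_mul] at h

end PolynomialFunctions

/-! ### Equivariant maps and change of universe -/

section Equivariance

variable {k : Type u} [Field k] {G : Type w} [Group G]
  {V : Type*} [AddCommGroup V] [Module k V] {V' : Type*} [AddCommGroup V'] [Module k V']
  {ρ : Representation k G V} {ρ' : Representation k G V'}

theorem isInvariant_iff {f : V → k} : IsInvariant ρ f ↔ ∀ g x, f (ρ g x) = f x := by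
  refine ⟨fun h g x => ?_, fun h g => funext fun x => h g⁻¹ x⟩
  have := congrFun (h g⁻¹) x
  simpa using this

theorem IsInvariant.comp {Φ : V → V'} (hΦ : ∀ g x, Φ (ρ g x) = ρ' g (Φ x)) {f : V' → k}
    (hf : IsInvariant ρ' f) : IsInvariant ρ (f ∘ Φ) :=
  isInvariant_iff.2 fun g x => by
    simp only [Function.comp_apply, hΦ, isInvariant_iff.1 hf g]

theorem map_mem_invariants {Φ : V → V'} (hΦ : ∀ g x, Φ (ρ g x) = ρ' g (Φ x)) {x : V}
    (hx : x ∈ ρ.invariants) : Φ x ∈ ρ'.invariants := fun g => by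
  rw [← hΦ, (Representation.mem_invariants ρ x).1 hx g]

theorem map_mem_nullcone (T : V →ₗ[k] V') (hT : ∀ g x, T (ρ g x) = ρ' g (T x)) {x : V}
    (hx : x ∈ nullcone ρ) : T x ∈ nullcone ρ' := fun f hf =>
  hx (f ∘ T) ⟨⟨comp_mem_polyFun T hf.1.1, hf.1.2.comp hT⟩, by simpa using hf.2⟩

theorem isDeltaSet_of_equiv (e : V ≃ₗ[k] V') (he : ∀ g x, e (ρ g x) = ρ' g (e x)) {d : ℕ}
    (h : IsDeltaSet ρ' (polyInvariantsLE ρ' d)) : IsDeltaSet ρ (polyInvariantsLE ρ d) := by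
  intro x hx hxN
  have he' : ∀ g y, e.symm (ρ' g y) = ρ g (e.symm y) := fun g y => by
    rw [e.symm_apply_eq, he, e.apply_symm_apply]
  obtain ⟨f, ⟨hf, hf0⟩, hfx⟩ := h (e x) (map_mem_invariants he hx) fun hN => hxN <| by
    simpa using map_mem_nullcone e.symm.toLinearMap he' hN
  exact ⟨f ∘ e, ⟨⟨comp_linear_mem_polyFunLE e.toLinearMap hf.1, hf.2.comp he⟩,
    by simpa using hf0⟩, hfx⟩

theorem isDeltaSet_mono {d e : ℕ} (hde : d ≤ e) (h : IsDeltaSet ρ (polyInvariantsLE ρ d)) :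
    IsDeltaSet ρ (polyInvariantsLE ρ e) := fun x hx hxN =>
  let ⟨f, ⟨hf, hf0⟩, hfx⟩ := h x hx hxN
  ⟨f, ⟨⟨polyFunLE_mono hde hf.1, hf.2⟩, hf0⟩, hfx⟩

theorem delta_le_natCast {d : ℕ} :
    delta ρ ≤ d ↔ IsDeltaSet ρ (polyInvariantsLE ρ d) := by
  refine ⟨fun h => ?_, fun h => iInf₂_le d h⟩
  have h' : delta ρ < (d + 1 : ℕ) := h.trans_lt (by exact_mod_cast Nat.lt_succ_self d)
  obtain ⟨e, he⟩ := iInf_lt_iff.1 h'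
  obtain ⟨hS, he⟩ := iInf_lt_iff.1 he
  exact isDeltaSet_mono (by exact_mod_cast Nat.lt_succ_iff.1 (by exact_mod_cast he)) hS

theorem delta_le_of_equiv (e : V ≃ₗ[k] V') (he : ∀ g x, e (ρ g x) = ρ' g (e x)) :
    delta ρ ≤ delta ρ' :=
  le_iInf₂ fun _ hd => delta_le_natCast.2 (isDeltaSet_of_equiv e he hd)

/-- Every `G`-module is isomorphic to one on some `kⁿ`, and so to one in the universe of `k`. -/
theorem exists_equivariant_equiv_fun [FiniteDimensional k V] {A : Subalgebra k (G → k)}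
    (hρ : IsRational A ρ) :
    ∃ (n : ℕ) (e : V ≃ₗ[k] (Fin n → k)) (σ : Representation k G (Fin n → k)),
      IsRational A σ ∧ ∀ g x, e (ρ g x) = σ g (e x) := by
  let e := (Module.finBasis k V).equivFun
  let σ : Representation k G (Fin (Module.finrank k V) → k) :=
    (e.conjAlgEquiv k : _ →* _).comp ρ
  have hσ : ∀ g y, σ g y = e (ρ g (e.symm y)) := fun g y => rfl
  refine ⟨_, e, σ, fun φ y => hρ (φ ∘ₗ e.toLinearMap) (e.symm y), fun g x => ?_⟩
  rw [hσ, e.symm_apply_apply]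

theorem delta_le_deltaGroup [FiniteDimensional k V] {A : Subalgebra k (G → k)}
    (hρ : IsRational A ρ) : delta ρ ≤ deltaGroup A := by
  obtain ⟨n, e, σ, hσ, he⟩ := exists_equivariant_equiv_fun hρ
  refine (delta_le_of_equiv e he).trans ?_
  exact le_iSup_of_le (Fin n → k) <| le_iSup_of_le _ <| le_iSup_of_le _ <|
    le_iSup_of_le inferInstance <| le_iSup₂_of_le σ hσ le_rfl

theorem IsReductive.eq_zero_of_mem_nullcone [FiniteDimensional k V] {A : Subalgebra k (G → k)}
    (hA : IsReductive A) (hρ : IsRational A ρ) {x : V} (hx : x ∈ ρ.invariants)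
    (hxN : x ∈ nullcone ρ) : x = 0 := by
  obtain ⟨n, e, σ, hσ, he⟩ := exists_equivariant_equiv_fun hρ
  have h := (hA (Fin n → k) σ hσ).subset
    ⟨map_mem_invariants he hx, map_mem_nullcone e.toLinearMap he hxN⟩
  simpa using h

/-- The one-dimensional trivial module shows that `δ(G) ≠ 0`. -/
theorem deltaGroup_ne_zero (A : Subalgebra k (G → k)) : deltaGroup A ≠ 0 := by
  intro h
  have hρ : IsRational A (1 : Representation k G k) := fun φ x => A.algebraMap_mem (φ x)
  have h0 := delta_le_natCast.1 ((delta_le_deltaGroup hρ).trans h.le)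
  have h1 : (1 : k) ∉ nullcone (1 : Representation k G k) := fun h1 => one_ne_zero <|
    h1 id ⟨⟨Algebra.subset_adjoin ⟨LinearMap.id, rfl⟩, fun g => rfl⟩, rfl⟩
  obtain ⟨f, ⟨hf, hf0⟩, hf1⟩ := h0 1 (fun g => rfl) h1
  exact hf1 (congrFun (eq_zero_of_mem_polyFunLE_zero hf.1 hf0) 1)

end Equivariance

/-! ### The dual of the space of invariants of a normal subgroup -/

section DualOfInvariants

variable {k : Type u} [Field k] {G : Type w} [Group G]
  {V : Type*} [AddCommGroup V] [Module k V] (ρ : Representation k G V)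

theorem regular_of_mem_polyFun {A : Subalgebra k (G → k)} {ρ} (hρ : IsRational A ρ) {f : V → k}
    (hf : f ∈ polyFun k V) (x : V) : (fun g => f (ρ g x)) ∈ A := by
  induction hf using Algebra.adjoin_induction with
  | mem f h =>
    obtain ⟨φ, rfl⟩ := h
    exact hρ φ x
  | algebraMap c => exact A.algebraMap_mem c
  | add f g _ _ hf hg => exact A.add_mem hf hg
  | mul f g _ _ hf hg => exact A.mul_mem hf hg

/-- `(k[V]^N_{≤ d})₊` as a vector space. -/
def invariantsPlus (N : Subgroup G) (d : ℕ) : Submodule k (V → k) where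
  carrier := plusPart (polyInvariantsLE (ρ.comp N.subtype) d)
  zero_mem' := ⟨⟨Submodule.zero_mem _, fun _ => rfl⟩, rfl⟩
  add_mem' {f g} hf hg := by
    refine ⟨⟨Submodule.add_mem _ hf.1.1 hg.1.1, isInvariant_iff.2 fun n x => ?_⟩, ?_⟩
    · simp only [Pi.add_apply, isInvariant_iff.1 hf.1.2 n, isInvariant_iff.1 hg.1.2 n]
    · simp [hf.2, hg.2]
  smul_mem' c f hf := by
    refine ⟨⟨Submodule.smul_mem _ c hf.1.1, isInvariant_iff.2 fun n x => ?_⟩, ?_⟩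
    · simp only [Pi.smul_apply, isInvariant_iff.1 hf.1.2 n]
    · simp [hf.2]

instance finite_invariantsPlus [FiniteDimensional k V] (N : Subgroup G) (d : ℕ) :
    Module.Finite k (invariantsPlus ρ N d) :=
  Module.Finite.of_injective (Submodule.inclusion fun _ hf => hf.1.1 :
    invariantsPlus ρ N d →ₗ[k] polyFunLE k V d) (Submodule.inclusion_injective _)

variable (N : Subgroup G) (d : ℕ)

/-- Evaluation of the functions in `(k[V]^N_{≤ d})₊` at a point. As a map from `V` it is
equivariant and polynomial of degree at most `d`. -/
def evalInvariantsPlus (x : V) : Module.Dual k (invariantsPlus ρ N d) :=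
  LinearMap.proj x ∘ₗ (invariantsPlus ρ N d).subtype

theorem comp_evalInvariantsPlus_mem [FiniteDimensional k V]
    (Φ : Module.Dual k (Module.Dual k (invariantsPlus ρ N d))) :
    Φ ∘ evalInvariantsPlus ρ N d ∈ polyFunLE k V d := by
  obtain ⟨f, rfl⟩ := (Module.evalEquiv k (invariantsPlus ρ N d)).surjective Φ
  exact f.2.1.1

/-- A function killed by all evaluations is zero, so the evaluations span the dual. Hence
rationality of the dual only has to be checked on evaluations. -/
theorem span_evalInvariantsPlus [FiniteDimensional k V] :
    Submodule.span k (Set.range (evalInvariantsPlus ρ N d)) = ⊤ := by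
  by_contra hne
  obtain ⟨Φ, hΦ, hle⟩ := Submodule.exists_le_ker_of_lt_top _ (lt_top_iff_ne_top.2 hne)
  obtain ⟨f, rfl⟩ := (Module.evalEquiv k (invariantsPlus ρ N d)).surjective Φ
  refine hΦ ?_
  have : f = 0 := Subtype.ext (funext fun x => hle (Submodule.subset_span ⟨x, rfl⟩))
  rw [this, map_zero]

variable [N.Normal]

variable {N d} in
theorem comp_mem_invariantsPlus {f : V → k} (hf : f ∈ invariantsPlus ρ N d) (g : G) :
    f ∘ ρ g ∈ invariantsPlus ρ N d := by
  refine ⟨⟨comp_linear_mem_polyFunLE (ρ g) hf.1.1, isInvariant_iff.2 fun n x => ?_⟩,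
    by simpa using hf.2⟩
  have h := isInvariant_iff.1 hf.1.2 ⟨g * n * g⁻¹, ‹N.Normal›.conj_mem n n.2 g⟩ (ρ g x)
  have h2 : ρ g (ρ n x) = ρ (g * n * g⁻¹) (ρ g x) := by
    simp only [← Module.End.mul_apply, ← map_mul, inv_mul_cancel_right]
  exact (congrArg f h2).trans h

/-- Precomposition with `ρ g`, as an endomorphism of `(k[V]^N_{≤ d})₊`; it is the action
of `g⁻¹`. -/
def invariantsPlusComp (g : G) : invariantsPlus ρ N d →ₗ[k] invariantsPlus ρ N d :=
  (LinearMap.funLeft k k (ρ g)).restrict fun _ hf => comp_mem_invariantsPlus ρ hf g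

@[simp]
theorem invariantsPlusComp_apply (g : G) (f : invariantsPlus ρ N d) (x : V) :
    (invariantsPlusComp ρ N d g f : V → k) x = (f : V → k) (ρ g x) :=
  rfl

/-- The `G ⧸ N`-module dual to `(k[V]^N_{≤ d})₊`. -/
def dualInvariantsPlus : Representation k (G ⧸ N) (Module.Dual k (invariantsPlus ρ N d)) :=
  QuotientGroup.lift N
    { toFun := fun g => (invariantsPlusComp ρ N d g).dualMap
      map_one' := by
        ext φ f
        refine congrArg φ (Subtype.ext (funext fun x => ?_))
        simp
      map_mul' := fun g h => by
        ext φ f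
        refine congrArg φ (Subtype.ext (funext fun x => ?_))
        simp }
    fun n hn => by
      ext φ f
      exact congrArg φ (Subtype.ext (funext fun x => isInvariant_iff.1 f.2.1.2 ⟨n, hn⟩ x))

theorem evalInvariantsPlus_map (g : G) (x : V) :
    evalInvariantsPlus ρ N d (ρ g x) =
      dualInvariantsPlus ρ N d (g : G ⧸ N) (evalInvariantsPlus ρ N d x) :=
  rfl

theorem isRational_dualInvariantsPlus [FiniteDimensional k V] {A : Subalgebra k (G → k)}
    {ρ : Representation k G V} (hρ : IsRational A ρ) :
    IsRational (quotientRegular A N) (dualInvariantsPlus ρ N d) := by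
  intro Φ φ
  obtain ⟨f, rfl⟩ := (Module.evalEquiv k (invariantsPlus ρ N d)).surjective Φ
  have hφ : φ ∈ Submodule.span k (Set.range (evalInvariantsPlus ρ N d)) := by
    rw [span_evalInvariantsPlus]; trivial
  change (fun g : G => φ (invariantsPlusComp ρ N d g f)) ∈ A
  induction hφ using Submodule.span_induction with
  | mem φ h =>
    obtain ⟨x, rfl⟩ := h
    exact regular_of_mem_polyFun hρ (polyFunLE_le_polyFun d f.2.1.1) x
  | zero => exact A.zero_mem
  | add φ ψ _ _ hφ hψ => exact A.add_mem hφ hψ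
  | smul c φ _ hφ => exact A.smul_mem hφ c

end DualOfInvariants

/-! ### Passing from a normal subgroup to the group -/

section Extension

variable {k : Type u} [Field k] {G : Type w} [Group G] {A : Subalgebra k (G → k)}
  {N : Subgroup G} {V : Type*} [AddCommGroup V] [Module k V]
  {ρ : Representation k G V}

theorem nullcone_comp_subset : nullcone (ρ.comp N.subtype) ⊆ nullcone ρ := fun _ hx f hf =>
  hx f ⟨⟨hf.1.1, fun n => hf.1.2 n⟩, hf.2⟩

theorem isRational_comp_subtype (hρ : IsRational A ρ) :
    IsRational (restrictRegular A N) (ρ.comp N.subtype) := fun φ x =>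
  ⟨_, hρ φ x, rfl⟩

variable [N.Normal]

/-- A fixed point `x` outside the nullcone gives the fixed point `ev_x ≠ 0` in the dual of
`(k[V]^N_{≤ d})₊`; an invariant of `G ⧸ N` not vanishing there is pulled back to `V`. -/
theorem isDeltaSet_mul [FiniteDimensional k V] (hρ : IsRational A ρ)
    (hR : IsReductive (quotientRegular A N)) {d e : ℕ}
    (hd : IsDeltaSet (ρ.comp N.subtype) (polyInvariantsLE (ρ.comp N.subtype) d))
    (he : deltaGroup (quotientRegular A N) ≤ e) :
    IsDeltaSet ρ (polyInvariantsLE ρ (d * e)) := by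
  intro x hx hxN
  obtain ⟨f, hf, hfx⟩ := hd x (fun n => hx n) fun h => hxN (nullcone_comp_subset h)
  have hev : evalInvariantsPlus ρ N d x ∈ (dualInvariantsPlus ρ N d).invariants := by
    intro g
    obtain ⟨g, rfl⟩ := QuotientGroup.mk_surjective g
    rw [← evalInvariantsPlus_map, (Representation.mem_invariants ρ x).1 hx g]
  have hrat := isRational_dualInvariantsPlus N d hρ
  have hevN : evalInvariantsPlus ρ N d x ∉ nullcone (dualInvariantsPlus ρ N d) := fun h =>
    hfx (LinearMap.congr_fun (hR.eq_zero_of_mem_nullcone hrat hev h) ⟨f, hf⟩)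
  obtain ⟨F, ⟨hF, hF0⟩, hFx⟩ :=
    delta_le_natCast.1 ((delta_le_deltaGroup hrat).trans he) _ hev hevN
  refine ⟨F ∘ evalInvariantsPlus ρ N d,
    ⟨⟨comp_mem_polyFunLE (comp_evalInvariantsPlus_mem ρ N d) hF.1,
      isInvariant_iff.2 fun g y => isInvariant_iff.1 hF.2 (g : G ⧸ N) (evalInvariantsPlus ρ N d y)⟩, ?_⟩, hFx⟩
  -- The functions in the dualized space vanish at `0`, so the pullback has no constant term.
  have h0 : evalInvariantsPlus ρ N d 0 = 0 := LinearMap.ext fun f => f.2.2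
  rw [Function.comp_apply, h0, hF0]

theorem delta_le_mul [FiniteDimensional k V] (hρ : IsRational A ρ)
    (hR : IsReductive (quotientRegular A N)) :
    delta ρ ≤ delta (ρ.comp N.subtype) * deltaGroup (quotientRegular A N) := by
  rcases eq_or_ne (delta (ρ.comp N.subtype)) 0 with h0 | h0
  · -- The product is `0` even if `δ(G ⧸ N)` is infinite.
    have hS := delta_le_natCast.1 h0.le
    rw [h0, zero_mul]
    refine delta_le_natCast.2 fun x hx hxN => ?_
    obtain ⟨f, ⟨hf, hf0⟩, hfx⟩ := hS x (fun n => hx n) fun h => hxN (nullcone_comp_subset h)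
    exact (hfx (congrFun (eq_zero_of_mem_polyFunLE_zero hf.1 hf0) x)).elim
  · have h1 := deltaGroup_ne_zero (quotientRegular A N)
    cases hd : delta (ρ.comp N.subtype) with
    | top => rw [ENat.top_mul h1]; exact le_top
    | coe d =>
      cases he : deltaGroup (quotientRegular A N) with
      | top => rw [ENat.mul_top (hd ▸ h0)]; exact le_top
      | coe e =>
        exact_mod_cast delta_le_natCast.2 (isDeltaSet_mul hρ hR (delta_le_natCast.1 hd.le) he.le)

theorem deltaGroup_le_mul (hR : IsReductive (quotientRegular A N)) :
    deltaGroup A ≤ deltaGroup (restrictRegular A N) * deltaGroup (quotientRegular A N) := by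
  simp only [deltaGroup, iSup_le_iff]
  intro V _ _ _ ρ hρ
  exact (delta_le_mul hρ hR).trans
    (mul_le_mul_left (delta_le_deltaGroup (isRational_comp_subtype hρ)) _)

end Extension

/-! ### The component group -/

section ComponentGroup

variable {k : Type u} [Field k] {G : Type w} [Group G]

/-- The product of the translates of a linear form is an invariant of a finite group. -/
theorem isReductive_of_finite [Finite G] (A : Subalgebra k (G → k)) : IsReductive A := by
  intro V _ _ _ ρ _
  have := Fintype.ofFinite G
  refine Set.Subset.antisymm (fun x ⟨hx, hxN⟩ => ?_) ?_
  · refine (Module.forall_dual_apply_eq_zero_iff k x).1 fun φ => ?_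
    have h := hxN (∏ g : G, ((φ ∘ₗ ρ g : Module.Dual k V) : V → k)) ⟨⟨?_, ?_⟩, ?_⟩
    · obtain ⟨g, -, hg⟩ := Finset.prod_eq_zero_iff.1 ((Finset.prod_apply _ _ _).symm.trans h)
      simpa [(Representation.mem_invariants ρ x).1 hx g] using hg
    · exact Subalgebra.prod_mem _ fun g _ =>
        Algebra.subset_adjoin (dual_mem_linearForms (φ ∘ₗ ρ g))
    · refine isInvariant_iff.2 fun h x => ?_
      simp only [Finset.prod_apply]
      refine Fintype.prod_equiv (Equiv.mulRight h) _ _ fun g => ?_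
      simp
    · simp [Finset.prod_apply]
  · rintro _ rfl
    exact ⟨Submodule.zero_mem _, fun f hf => hf.2⟩

namespace IsLinearAlgebraicGroup

variable {A : Subalgebra k (G → k)}

/-- Points are sent to their maximal ideals in `A`. The Zariski topology on `G` is induced from
the prime spectrum of the Noetherian ring `A`. -/
theorem noetherianSpace (hA : IsLinearAlgebraicGroup A) :
    @TopologicalSpace.NoetherianSpace G (zariskiTopology A) := by
  let _ := zariskiTopology A
  have : Algebra.FiniteType k A := A.fg_iff_finiteType.1 hA.fg
  have : IsNoetherianRing A := Algebra.FiniteType.isNoetherianRing k A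
  let ev : G → A →+* k := fun g => (Pi.evalRingHom (fun _ => k) g).comp A.val.toRingHom
  let i : G → PrimeSpectrum A := fun g => ⟨RingHom.ker (ev g), RingHom.ker_isPrime _⟩
  have hi : Topology.IsInducing i := by
    refine ⟨?_⟩
    rw [PrimeSpectrum.isTopologicalBasis_basic_opens.eq_generateFrom, induced_generateFrom_eq]
    refine congrArg TopologicalSpace.generateFrom (Set.ext fun U => ?_)
    constructor
    · rintro ⟨f, hf, rfl⟩
      exact ⟨_, ⟨⟨f, hf⟩, rfl⟩, rfl⟩
    · rintro ⟨_, ⟨f, rfl⟩, rfl⟩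
      exact ⟨f, f.2, rfl⟩
  exact hi.noetherianSpace

/-- Distinct cosets of `G⁰` lie in distinct connected components, and these are finite in number
because each irreducible component lies in one of them. -/
theorem finite_quotient_identityComponent (hA : IsLinearAlgebraicGroup A) :
    Finite (G ⧸ hA.identityComponent) := by
  let _ := zariskiTopology A
  have := hA.noetherianSpace
  have hfin : (irreducibleComponents G).Finite :=
    TopologicalSpace.NoetherianSpace.finite_irreducibleComponents
  have : Finite (irreducibleComponents G) := hfin
  refine Finite.of_injective (β := irreducibleComponents G)
    (fun q => ⟨irreducibleComponent q.out, irreducibleComponent_mem_irreducibleComponents _⟩)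
    fun p q hpq => ?_
  have hpq : irreducibleComponent p.out = irreducibleComponent q.out := congrArg Subtype.val hpq
  have hmem : q.out ∈ connectedComponent p.out :=
    irreducibleComponent_subset_connectedComponent (hpq ▸ mem_irreducibleComponent)
  have h := (continuous_of_pullback
    (fun f hf => hA.mul_left p.out⁻¹ hf)).image_connectedComponent_subset _
    (Set.mem_image_of_mem _ hmem)
  rw [inv_mul_cancel] at h
  rw [← p.out_eq', ← q.out_eq']
  exact QuotientGroup.eq.2 h

end IsLinearAlgebraicGroup

end ComponentGroup

end LinAlgGroup

theorem mainTheorem9 {k : Type u} [Field k] [IsAlgClosed k] {G : Type w} [Group G]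
    (A : Subalgebra k (G → k)) (hA : IsLinearAlgebraicGroup A) :
    (∀ (N : Subgroup G) [N.Normal], IsClosed[zariskiTopology A] (N : Set G) →
      IsReductive (quotientRegular A N) →
      (∀ (V : Type v) [AddCommGroup V] [Module k V] [FiniteDimensional k V]
        (ρ : Representation k G V), IsRational A ρ →
        delta ρ ≤ delta (ρ.comp N.subtype) * deltaGroup (quotientRegular A N) ∧
        delta (ρ.comp N.subtype) * deltaGroup (quotientRegular A N) ≤
          deltaGroup (restrictRegular A N) * deltaGroup (quotientRegular A N)) ∧
      deltaGroup A ≤ deltaGroup (restrictRegular A N) * deltaGroup (quotientRegular A N)) ∧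
    deltaGroup A ≤ deltaGroup (quotientRegular A hA.identityComponent) *
      deltaGroup (restrictRegular A hA.identityComponent) := by
  refine ⟨fun N _ _ hR => ⟨fun V _ _ _ ρ hρ => ⟨delta_le_mul hρ hR, ?_⟩,
    deltaGroup_le_mul hR⟩, ?_⟩
  · exact mul_le_mul_left (delta_le_deltaGroup (isRational_comp_subtype hρ)) _
  · have := hA.finite_quotient_identityComponent
    rw [mul_comm]
    exact deltaGroup_le_mul (isReductive_of_finite _)
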